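/- Let $G$ be a finite bi-block graph, i.e. a finite connected simple graph each of whose blocks (maximal connected subgraphs without a cut-vertex) is a complete bipartite graph. Suppose $G$ has exactly $r>1$ blocks $K_{m_1,n_1},\dots,K_{m_r,n_r}$, where the vertex set of the $i$-th block is partitioned into its two parts $X_i\cup Y_i$ with $|X_i|=m_i$, $|Y_i|=n_i$. Let $q$ be an element of a field (for example a number or an indeterminate) such that $q\neq -1$ and, for every $1\le i\le r$, $$q^2(m_i-1)(n_i-1)\neq 1\qquad\text{and}\qquad (q+1)^2(m_i-1)(n_i-1)\neq m_in_i .$$ Put $\delta_i=q^2(m_i-1)(n_i-1)-1$, and for a vertex $v$ let $\hat d(v)$ be the number of blocks containing $v$. Define * the $q$-distance matrix $\mathscr D$, indexed by the vertices: $\mathscr D_{uv}=1+q+\cdots+q^{d(u,v)-1}$ if $u\ne v$, where $d(u,v)$ is the graph distance, and $\mathscr D_{uu}=0$; * the vectors $$\mathbf x(v)=\sum_{i:\,v\in X_i}\frac{q(n_i-1)-1}{(q+1)\delta_i}+\sum_{i:\,v\in Y_i}\frac{q(m_i-1)-1}{(q+1)\delta_i}-(\hat d(v)-1),$$ $$\mathbf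 y(v)=\sum_{i:\,v\in X_i}\frac{n_i-1}{\delta_i}+\sum_{i:\,v\in Y_i}\frac{m_i-1}{\delta_i}-(\hat d(v)-1);$$ * the matrix $\mathbf A$ with $\mathbf A_{uv}=1/\delta_i$ if $u,v$ are adjacent and lie in the $i$-th block, and $\mathbf A_{uv}=0$ if $u,v$ are not adjacent; * the matrix $\mathbf B$ with $\mathbf B_{uv}=(n_i-1)/\delta_i$ if $u\neq v$ are non-adjacent and both lie in $X_i$, $\mathbf B_{uv}=(m_i-1)/\delta_i$ if $u\neq v$ are non-adjacent and both lie in $Y_i$, and $\mathbf B_{uv}=0$ otherwise; * the matrix $$\mathscr L=\frac{q}{q+1}\mathbf A-\frac{q^2}{q+1}\mathbf B-\frac{q^2}{q+1}\operatorname{diag}(\mathbf y)+\frac1{q+1}\mathbf I .$$ Then $$\mathscr D\mathscr L+\mathbf I=\mathbb 1\,\mathbf x^{T},$$ where $\mathbb 1$ is the all-ones column vector. -/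

import Mathlib

namespace BiBlock

variable {V : Type*}

/-- `v` is a cut-vertex of `H`: deleting it disconnects `H`.
(The empty graph is preconnected, so a single vertex is not a cut-vertex of `K₁`.) -/
def IsCutVertex {G : SimpleGraph V} (H : G.Subgraph) (v : V) : Prop :=
  v ∈ H.verts ∧ ¬ (H.deleteVerts {v}).Preconnected

/-- A block of `G` is a maximal connected subgraph without cut-vertices. -/
def IsBlock {G : SimpleGraph V} (H : G.Subgraph) : Prop :=
  Maximal (fun K : G.Subgraph => K.Connected ∧ ∀ v, ¬ IsCutVertex K v) H

/-- `H` is a complete bipartite graph with parts `X` and `Y`. -/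
structure IsCompleteBipartite [DecidableEq V] {G : SimpleGraph V} (H : G.Subgraph)
    (X Y : Finset V) : Prop where
  nonempty_left : X.Nonempty
  nonempty_right : Y.Nonempty
  disjoint : Disjoint X Y
  verts_eq : H.verts = ((X ∪ Y : Finset V) : Set V)
  adj_iff : ∀ u v, H.Adj u v ↔ (u ∈ X ∧ v ∈ Y) ∨ (u ∈ Y ∧ v ∈ X)

/-- A bi-block graph: a connected graph each of whose blocks is complete bipartite. -/
def IsBiBlockGraph [DecidableEq V] (G : SimpleGraph V) : Prop :=
  G.Connected ∧ ∀ H : G.Subgraph, IsBlock H → ∃ X Y : Finset V, IsCompleteBipartite H X Y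

/-- A numbering of the blocks of `G` by `Fin r`, each block once (so `G` has exactly `r` blocks),
with a choice of the two parts `X i`, `Y i` of the `i`-th block. -/
structure BlockLabelling [DecidableEq V] (G : SimpleGraph V) (r : ℕ) where
  block : Fin r ≃ {H : G.Subgraph // IsBlock H}
  X : Fin r → Finset V
  Y : Fin r → Finset V
  isCompleteBipartite : ∀ i, IsCompleteBipartite (block i).1 (X i) (Y i)

/-- The `q`-distance matrix: the entry is `1 + q + ⋯ + q ^ (d - 1)` for vertices at
distance `d ≥ 1`, and `0` on the diagonal. -/
noncomputable def qDistMatrix {K : Type*} [Field K] (G : SimpleGraph V) (q : K) : Matrix V V K :=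
  Matrix.of fun u v => ∑ k ∈ Finset.range (G.dist u v), q ^ k

namespace BlockLabelling

variable [DecidableEq V] {G : SimpleGraph V} {r : ℕ} {K : Type*} [Field K]

/-- The size `m i` of the part `X i`. -/
def m (P : BlockLabelling G r) (i : Fin r) : ℕ := (P.X i).card

/-- The size `n i` of the part `Y i`. -/
def n (P : BlockLabelling G r) (i : Fin r) : ℕ := (P.Y i).card

/-- `q ≠ -1` and `q² (mᵢ - 1) (nᵢ - 1) ≠ 1` for all `i`. -/
def Condition1 (P : BlockLabelling G r) (q : K) : Prop :=
  q ≠ -1 ∧ ∀ i, q ^ 2 * ((P.m i : K) - 1) * ((P.n i : K) - 1) ≠ 1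

/-- `q ≠ -1` and `(q + 1)² (mᵢ - 1) (nᵢ - 1) ≠ mᵢ nᵢ` for all `i`. -/
def Condition2 (P : BlockLabelling G r) (q : K) : Prop :=
  q ≠ -1 ∧ ∀ i, (q + 1) ^ 2 * ((P.m i : K) - 1) * ((P.n i : K) - 1) ≠ (P.m i : K) * (P.n i : K)

/-- The quantity `q² (mᵢ - 1) (nᵢ - 1) - 1`. -/
noncomputable def den (P : BlockLabelling G r) (q : K) (i : Fin r) : K :=
  q ^ 2 * ((P.m i : K) - 1) * ((P.n i : K) - 1) - 1

/-- The block degree of `v`: the number of blocks that contain `v`. -/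
def blockDegree (P : BlockLabelling G r) (v : V) : ℕ :=
  (Finset.univ.filter fun i => v ∈ P.X i ∪ P.Y i).card

/-- The vector `x`. -/
noncomputable def x (P : BlockLabelling G r) (q : K) (v : V) : K :=
  (∑ i, if v ∈ P.X i then (q * ((P.n i : K) - 1) - 1) / ((q + 1) * P.den q i) else 0)
  + (∑ i, if v ∈ P.Y i then (q * ((P.m i : K) - 1) - 1) / ((q + 1) * P.den q i) else 0)
  - ((P.blockDegree v : K) - 1)

/-- The vector `y`. -/
noncomputable def y (P : BlockLabelling G r) (q : K) (v : V) : K :=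
  (∑ i, if v ∈ P.X i then ((P.n i : K) - 1) / P.den q i else 0)
  + (∑ i, if v ∈ P.Y i then ((P.m i : K) - 1) / P.den q i else 0)
  - ((P.blockDegree v : K) - 1)

open Classical in
/-- The weighted adjacency matrix `A`. Two adjacent vertices lie in exactly one common block,
so the sum has one term, the weight of that block. -/
noncomputable def A (P : BlockLabelling G r) (q : K) : Matrix V V K :=
  Matrix.of fun u v => ∑ i,
    if G.Adj u v ∧ u ∈ P.X i ∪ P.Y i ∧ v ∈ P.X i ∪ P.Y i then 1 / P.den q i else 0

open Classical in
/-- The weighted adjacency matrix `B` of the complement. Two distinct vertices lie in at most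
one common block, so the sum has at most one nonzero term. -/
noncomputable def B (P : BlockLabelling G r) (q : K) : Matrix V V K :=
  Matrix.of fun u v => ∑ i,
    if u ≠ v ∧ ¬ G.Adj u v ∧ u ∈ P.X i ∧ v ∈ P.X i then ((P.n i : K) - 1) / P.den q i
    else if u ≠ v ∧ ¬ G.Adj u v ∧ u ∈ P.Y i ∧ v ∈ P.Y i then ((P.m i : K) - 1) / P.den q i
    else 0

/-- The Laplacian-like matrix `L`. -/
noncomputable def L (P : BlockLabelling G r) (q : K) : Matrix V V K :=
  (q / (q + 1)) • P.A q - (q ^ 2 / (q + 1)) • P.B q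
    - (q ^ 2 / (q + 1)) • Matrix.diagonal (P.y q) + (1 / (q + 1)) • (1 : Matrix V V K)

end BlockLabelling

end BiBlock

/-!
The identity is assembled from one identity per block.

A path of `G` between two vertices of a block stays inside the block
(`BiBlock.IsBlock.toSubgraph_le`), because attaching an ear creates no cut-vertex. Hence every
vertex `u` has a gate `c` in every block `H`, a vertex of `H` through which all walks from `u` to
`H` pass (`BiBlock.IsBlock.exists_isGate`), and `dist u w = dist u c + dist c w` for `w` in `H`.
Writing `[d] = 1 + ⋯ + q ^ (d - 1)`, this gives `[dist u w] = [d] + q ^ d * [dist c w]` on `H`,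
where `d = dist u c`.

Up to a diagonal correction, `L` is the sum over the blocks of matrices supported on the blocks
(`BiBlock.BlockLabelling.L_eq_sum_blockL`). In a block the distances are `0`, `1` and `2`, and a
direct computation shows that the row of `u` in the `q`-distance matrix, multiplied with the column
of `v` in the part of `L` coming from one block at `v`, is the term of `x v` for this block, minus
`q ^ dist u v` if `v` is itself the gate of `u` in the block
(`BiBlock.BlockLabelling.sum_qDistMatrix_mul_blockL`).

It remains to count the blocks in which `v` is the gate of `u`. If `u = v`, these are all blocks at
`v`. Otherwise they are all but one, the exception being the block that contains the last edge of
a geodesic from `u` to `v` (`BiBlock.existsUnique_isBlock_not_isGate`). With this count the diagonal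
correction turns the sum of the block terms into `x v`.
-/

namespace BiBlock

open SimpleGraph

section Blocks

variable {V : Type*} {G : SimpleGraph V}

/-! ### Nonseparable subgraphs and blocks -/

/-- A subgraph is nonseparable if it is connected and has no cut-vertex. Blocks are the maximal
nonseparable subgraphs. -/
def IsNonseparable (H : G.Subgraph) : Prop :=
  H.Connected ∧ ∀ v, ¬ IsCutVertex H v

theorem IsNonseparable.preconnected_deleteVerts {H : G.Subgraph} (hH : IsNonseparable H) (x : V) :
    (H.deleteVerts {x}).Preconnected := by
  by_cases hx : x ∈ H.verts
  · by_contra h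
    exact hH.2 x ⟨hx, h⟩
  · have h : ({x} : Set V) ∩ H.verts = ∅ := by
      simpa using hx
    rw [← Subgraph.deleteVerts_inter_verts_set_right_eq, h, Subgraph.deleteVerts_empty]
    exact hH.1.preconnected

theorem isNonseparable_of_preconnected_deleteVerts {H : G.Subgraph} (hc : H.Connected)
    (hd : ∀ x, (H.deleteVerts {x}).Preconnected) : IsNonseparable H :=
  ⟨hc, fun x hx => hx.2 (hd x)⟩

theorem IsNonseparable.sup {H K : G.Subgraph} (hH : IsNonseparable H) (hK : IsNonseparable K)
    {a b : V} (hab : a ≠ b) (haH : a ∈ H.verts) (haK : a ∈ K.verts) (hbH : b ∈ H.verts)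
    (hbK : b ∈ K.verts) : IsNonseparable (H ⊔ K) := by
  refine isNonseparable_of_preconnected_deleteVerts
    (Subgraph.connected_sup hH.1.preconnected hK.1.preconnected ⟨a, haH, haK⟩) fun x => ?_
  have hsup : (H ⊔ K).deleteVerts {x} = H.deleteVerts {x} ⊔ K.deleteVerts {x} := by
    ext u v
    · simp only [Subgraph.deleteVerts_verts, Subgraph.verts_sup]
      grind
    · simp only [Subgraph.deleteVerts_adj, Subgraph.sup_adj, Subgraph.verts_sup]
      constructor
      · rintro ⟨-, hu, -, hv, h | h⟩
        · exact Or.inl ⟨h.fst_mem, hu, h.snd_mem, hv, h⟩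
        · exact Or.inr ⟨h.fst_mem, hu, h.snd_mem, hv, h⟩
      · rintro (⟨hu, hu', hv, hv', h⟩ | ⟨hu, hu', hv, hv', h⟩)
        · exact ⟨Or.inl hu, hu', Or.inl hv, hv', Or.inl h⟩
        · exact ⟨Or.inr hu, hu', Or.inr hv, hv', Or.inr h⟩
  rw [hsup]
  refine (Subgraph.connected_sup (hH.preconnected_deleteVerts x)
    (hK.preconnected_deleteVerts x) ?_).preconnected
  by_cases hxa : a = x
  · exact ⟨b, ⟨hbH, fun h => hab (hxa.trans h.symm)⟩, ⟨hbK, fun h => hab (hxa.trans h.symm)⟩⟩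
  · exact ⟨a, ⟨haH, hxa⟩, ⟨haK, hxa⟩⟩

theorem isNonseparable_subgraphOfAdj {u v : V} (h : G.Adj u v) :
    IsNonseparable (G.subgraphOfAdj h) := by
  refine isNonseparable_of_preconnected_deleteVerts (Subgraph.subgraphOfAdj_connected h)
    fun x => ?_
  by_cases hx : x = u ∨ x = v
  · have : Subsingleton ((G.subgraphOfAdj h).deleteVerts {x}).verts := by
      rw [Set.subsingleton_coe]
      intro a ha b hb
      simp only [Subgraph.deleteVerts_verts, subgraphOfAdj_verts, Set.mem_sdiff,
        Set.mem_insert_iff, Set.mem_singleton_iff] at ha hb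
      grind
    exact ⟨Preconnected.of_subsingleton⟩
  · have h' : ({x} : Set V) ∩ (G.subgraphOfAdj h).verts = ∅ := by
      simpa using hx
    rw [← Subgraph.deleteVerts_inter_verts_set_right_eq, h', Subgraph.deleteVerts_empty]
    exact (Subgraph.subgraphOfAdj_connected h).preconnected

theorem toSubgraph_le_deleteVerts {K : G.Subgraph} {x u v : V} {p : G.Walk u v}
    (hp : p.toSubgraph ≤ K) (hx : x ∉ p.support) : p.toSubgraph ≤ K.deleteVerts {x} := by
  have hne : ∀ w ∈ p.toSubgraph.verts, w ∉ ({x} : Set V) := by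
    rintro w hw rfl
    exact hx ((p.mem_verts_toSubgraph).1 hw)
  refine ⟨fun w hw => ⟨hp.1 hw, hne w hw⟩, fun a b hab => ?_⟩
  exact Subgraph.deleteVerts_adj.2 ⟨hp.1 hab.fst_mem, hne a hab.fst_mem, hp.1 hab.snd_mem,
    hne b hab.snd_mem, hp.2 hab⟩

theorem preconnected_of_forall_exists_walk {H K : G.Subgraph} (hle : H ≤ K)
    (hH : H.Preconnected)
    (h : ∀ w ∈ K.verts, ∃ a ∈ H.verts, ∃ p : G.Walk w a, p.toSubgraph ≤ K) :
    K.Preconnected := by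
  rw [Subgraph.preconnected_iff_forall_exists_walk_subgraph] at hH ⊢
  intro u v hu hv
  obtain ⟨a, ha, p, hp⟩ := h u hu
  obtain ⟨b, hb, s, hs⟩ := h v hv
  obtain ⟨t, ht⟩ := hH ha hb
  refine ⟨(p.append t).append s.reverse, ?_⟩
  simp only [Walk.toSubgraph_append, Walk.toSubgraph_reverse]
  exact sup_le (sup_le hp (ht.trans hle)) hs

/-- Attaching an ear: a vertex `w` of the path splits it into two pieces with only `w` in common,
so after the deletion of any other vertex one of the pieces still leads from `w` to `H`. -/
theorem IsNonseparable.sup_toSubgraph {H : G.Subgraph} (hH : IsNonseparable H) {a b : V}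
    (ha : a ∈ H.verts) (hb : b ∈ H.verts) {p : G.Walk a b} (hp : p.IsPath) :
    IsNonseparable (H ⊔ p.toSubgraph) := by
  classical
  refine isNonseparable_of_preconnected_deleteVerts
    (Subgraph.connected_sup hH.1.preconnected p.toSubgraph_connected.preconnected
      ⟨a, ha, p.start_mem_verts_toSubgraph⟩) fun x => ?_
  refine preconnected_of_forall_exists_walk (Subgraph.deleteVerts_mono le_sup_left)
    (hH.preconnected_deleteVerts x) ?_
  rintro w ⟨hw | hw, hwx⟩
  · refine ⟨w, ⟨hw, hwx⟩, Walk.nil, toSubgraph_le_deleteVerts ?_ (by simpa using Ne.symm hwx)⟩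
    simpa using Or.inl hw
  · have hw' : w ∈ p.support := p.mem_verts_toSubgraph.1 hw
    have hsplit := congrArg Walk.toSubgraph (p.take_spec hw')
    rw [Walk.toSubgraph_append] at hsplit
    by_cases hx : x ∈ (p.takeUntil w hw').support
    · have hx' : x ∉ (p.dropUntil w hw').support := by
        intro hx'
        have hp' := hp
        rw [← p.take_spec hw'] at hp'
        exact hp'.ne_of_mem_support_of_append (Ne.symm hwx) hx hx' rfl
      refine ⟨b, ⟨hb, ?_⟩, p.dropUntil w hw', toSubgraph_le_deleteVerts ?_ hx'⟩
      · rintro rfl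
        exact hx' (Walk.end_mem_support _)
      · exact (hsplit ▸ le_sup_right : _ ≤ p.toSubgraph).trans le_sup_right
    · refine ⟨a, ⟨ha, ?_⟩, (p.takeUntil w hw').reverse, toSubgraph_le_deleteVerts ?_ ?_⟩
      · rintro rfl
        exact hx (Walk.start_mem_support _)
      · rw [Walk.toSubgraph_reverse]
        exact (hsplit ▸ le_sup_left : _ ≤ p.toSubgraph).trans le_sup_right
      · simpa using hx

theorem IsBlock.isNonseparable {H : G.Subgraph} (hH : IsBlock H) : IsNonseparable H :=
  hH.prop

/-- A path between two vertices of a block stays inside the block. -/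
theorem IsBlock.toSubgraph_le {H : G.Subgraph} (hH : IsBlock H) {a b : V}
    (ha : a ∈ H.verts) (hb : b ∈ H.verts) {p : G.Walk a b} (hp : p.IsPath) :
    p.toSubgraph ≤ H :=
  le_sup_right.trans
    (hH.le_of_ge (hH.isNonseparable.sup_toSubgraph ha hb hp) le_sup_left)

theorem IsBlock.adj_of_adj {H : G.Subgraph} (hH : IsBlock H) {u v : V} (hu : u ∈ H.verts)
    (hv : v ∈ H.verts) (h : G.Adj u v) : H.Adj u v := by
  have hp : h.toWalk.IsPath := h.isPath_toWalk
  refine (hH.toSubgraph_le hu hv hp).2 ?_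
  rw [h.toSubgraph_toWalk]
  simp

theorem IsBlock.eq_of_two_common_vertices {H K : G.Subgraph} (hH : IsBlock H) (hK : IsBlock K)
    {a b : V} (hab : a ≠ b) (haH : a ∈ H.verts) (haK : a ∈ K.verts) (hbH : b ∈ H.verts)
    (hbK : b ∈ K.verts) : H = K := by
  have h : IsNonseparable (H ⊔ K) :=
    hH.isNonseparable.sup hK.isNonseparable hab haH haK hbH hbK
  exact (hH.eq_of_le h le_sup_left).trans (hK.eq_of_le h le_sup_right).symm

theorem exists_isBlock_of_adj [Finite V] {u v : V} (h : G.Adj u v) :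
    ∃ H : G.Subgraph, IsBlock H ∧ u ∈ H.verts ∧ v ∈ H.verts := by
  obtain ⟨H, hle, hH⟩ := Finite.exists_le_maximal
    (p := fun K : G.Subgraph => K.Connected ∧ ∀ v, ¬ IsCutVertex K v)
    (isNonseparable_subgraphOfAdj h)
  exact ⟨H, hH, hle.1 (by simp), hle.1 (by simp)⟩

/-! ### Gates of a vertex in the blocks -/

/-- `c` is the gate of `u` in `H`: the vertex of `H` nearest to `u`, through which all walks from
`u` to `H` pass. -/
structure IsGate (H : G.Subgraph) (u c : V) : Prop where
  mem : c ∈ H.verts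
  mem_support : ∀ ⦃w⦄, w ∈ H.verts → ∀ p : G.Walk u w, c ∈ p.support

/-- A walk from `u` to `H` that misses the nearest vertex `c`, preceded by a geodesic from `c` to
`u`, contains a path between two vertices of `H`. That path stays inside `H`, hence leaves `c`
along an edge of the geodesic to a vertex of `H` that is nearer to `u`. -/
theorem IsBlock.exists_isGate {H : G.Subgraph} (hG : G.Connected) (hH : IsBlock H) (u : V) :
    ∃ c, IsGate H u c := by
  classical
  obtain ⟨c, hc, hmin⟩ : ∃ c ∈ H.verts, ∀ w ∈ H.verts, G.dist u c ≤ G.dist u w := by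
    obtain ⟨c, hc⟩ := hH.isNonseparable.1.nonempty
    exact ⟨_, Function.argminOn_mem (G.dist u) H.verts ⟨c, hc⟩,
      fun w hw => Function.argminOn_le (G.dist u) H.verts hw⟩
  refine ⟨c, hc, fun w hw p => ?_⟩
  by_cases hcw : c = w
  · exact hcw ▸ p.end_mem_support
  obtain ⟨s, hs⟩ := hG.exists_walk_length_eq_dist u c
  have hle := hH.toSubgraph_le hc hw ((s.reverse.append p).bypass_isPath)
  set t := (s.reverse.append p).bypass with ht
  have hadj := t.toSubgraph_adj_snd (Walk.not_nil_of_ne hcw)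
  have hmem := Walk.edges_bypass_subset_edges _ (Walk.adj_toSubgraph_iff_mem_edges.1 hadj)
  rw [Walk.edges_append, List.mem_append, Walk.edges_reverse, List.mem_reverse] at hmem
  rcases hmem with hmem | hmem
  · have hsnd := s.snd_mem_support_of_mem_edges hmem
    have h1 := hmin _ (hle.1 hadj.snd_mem)
    have h2 := s.length_takeUntil_lt_length hsnd hadj.ne.symm
    have h3 := G.dist_le (s.takeUntil _ hsnd)
    omega
  · exact p.fst_mem_support_of_mem_edges hmem

theorem IsGate.dist_add_dist {H : G.Subgraph} (hG : G.Connected) {u c w : V}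
    (hc : IsGate H u c) (hw : w ∈ H.verts) : G.dist u w = G.dist u c + G.dist c w := by
  classical
  obtain ⟨p, hp⟩ := hG.exists_walk_length_eq_dist u w
  have hmem := hc.mem_support hw p
  have h1 := G.dist_le (p.takeUntil c hmem)
  have h2 := G.dist_le (p.dropUntil c hmem)
  have h3 := congrArg Walk.length (p.take_spec hmem)
  rw [Walk.length_append] at h3
  have h4 := hG.dist_triangle (u := u) (v := c) (w := w)
  omega

theorem IsGate.unique {H : G.Subgraph} (hG : G.Connected) {u c v : V} (hc : IsGate H u c)
    (hv : IsGate H u v) : c = v := by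
  have h1 := hc.dist_add_dist hG hv.mem
  have h2 := hv.dist_add_dist hG hc.mem
  exact hG.dist_eq_zero_iff.1 (by omega)

/-- The last edge of a geodesic from `u` to `v` lies in exactly one block, and that is the only
block at `v` whose gate for `u` differs from `v`. -/
theorem existsUnique_isBlock_not_isGate [Finite V] (hG : G.Connected) {u v : V} (huv : u ≠ v) :
    ∃! H : G.Subgraph, IsBlock H ∧ v ∈ H.verts ∧ ¬ IsGate H u v := by
  classical
  obtain ⟨p, hp, hlen⟩ := hG.exists_path_of_dist u v
  have hnil : ¬ p.Nil := Walk.not_nil_of_ne huv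
  have hadj : G.Adj p.penultimate v := p.adj_penultimate hnil
  obtain ⟨H, hH, hwH, hvH⟩ := exists_isBlock_of_adj hadj
  refine ⟨H, ⟨hH, hvH, fun hg => ?_⟩, ?_⟩
  · have h1 := hg.dist_add_dist hG hwH
    have h2 := G.dist_le p.dropLast
    have h3 : p.dropLast.length + 1 = p.length := Walk.length_dropLast_add_one hnil
    omega
  · rintro K ⟨hK, hvK, hgK⟩
    refine hK.eq_of_two_common_vertices hH hadj.ne ?_ hwH hvK hvH
    obtain ⟨c, hc⟩ := hK.exists_isGate hG u
    have hcv : c ≠ v := by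
      rintro rfl
      exact hgK hc
    have hmem := hc.mem_support hvK p
    have hle := hK.toSubgraph_le hc.mem hvK (hp.dropUntil hmem)
    have hpen : (p.dropUntil c hmem).penultimate = p.penultimate := by
      have hpos : 0 < (p.dropUntil c hmem).length :=
        Walk.not_nil_iff_lt_length.1 (Walk.not_nil_of_ne hcv)
      conv_rhs => rw [← p.take_spec hmem]
      rw [Walk.penultimate, Walk.penultimate, Walk.getVert_append, Walk.length_append,
        if_neg (by omega)]
      congr 1
      omega
    rw [← hpen]
    exact hle.1 ((p.dropUntil c hmem).toSubgraph_adj_penultimate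
      (Walk.not_nil_of_ne hcv)).fst_mem

end Blocks

/-! ### The identity for a single complete bipartite graph -/

section BlockIdentity

variable {K : Type*} [Field K] {V : Type*} [DecidableEq V]

/-- The column of a block at `v ∈ X`, summed against the function `s + t * [dist c ·]` on the
complete bipartite graph with parts `X` and `Y`. Here `s` and `t` stand for `1 + ⋯ + q ^ (d - 1)`
and `q ^ d`, where `d` is the distance to the gate `c`. -/
theorem sum_completeBipartite_column {X Y : Finset V} (hXY : Disjoint X Y) {q δ s t : K}
    (hq : q + 1 ≠ 0) (hδ : δ = q ^ 2 * ((X.card : K) - 1) * ((Y.card : K) - 1) - 1)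
    (hδ0 : δ ≠ 0) (hst : (1 - q) * s = 1 - t) {v c : V} (hv : v ∈ X) (hc : c ∈ X ∪ Y) (f : V → K)
    (hf0 : f c = s)
    (hf1 : ∀ w ∈ X ∪ Y, (w ∈ X ↔ c ∈ Y) → f w = s + t)
    (hf2 : ∀ w ∈ X ∪ Y, (w ∈ X ↔ c ∈ X) → w ≠ c → f w = s + t * (1 + q)) :
    q / (q + 1) * (1 / δ) * ∑ w ∈ Y, f w
        - q ^ 2 / (q + 1) * (((Y.card : K) - 1) / δ) * ∑ w ∈ X, f w + 1 / (q + 1) * f v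
      = (q * ((Y.card : K) - 1) - 1) / ((q + 1) * δ) - if c = v then t else 0 := by
  have hnot : ∀ w, w ∈ X → w ∉ Y := fun w h h' => Finset.disjoint_left.1 hXY h h'
  have hsum : ∀ Z : Finset V, c ∈ Z → (∀ w ∈ Z, w ≠ c → f w = s + t * (1 + q)) →
      ∑ w ∈ Z, f w = Z.card * s + t * (1 + q) * ((Z.card : K) - 1) := by
    intro Z hcZ hZ
    rw [← Finset.add_sum_erase Z f hcZ, hf0,
      Finset.sum_congr rfl fun w hw => hZ w (Finset.mem_of_mem_erase hw) (Finset.ne_of_mem_erase hw),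
      Finset.sum_const, Finset.card_erase_of_mem hcZ, nsmul_eq_mul,
      Nat.cast_pred (Finset.card_pos.2 ⟨c, hcZ⟩)]
    ring
  -- Eliminating `t` rather than dividing by `1 - q` covers the case `q = 1` as well.
  have ht : t = 1 - (1 - q) * s := by rw [hst]; ring
  rcases Finset.mem_union.1 hc with hcX | hcY
  · have hY : ∑ w ∈ Y, f w = Y.card * (s + t) := by
      rw [Finset.sum_congr rfl fun w hw => hf1 w (Finset.mem_union_right _ hw)
        ⟨fun h => absurd hw (hnot w h), fun h => absurd h (hnot c hcX)⟩]
      simp [mul_add]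
    have hX := hsum X hcX fun w hw hwc =>
      hf2 w (Finset.mem_union_left _ hw) (iff_of_true hw hcX) hwc
    rw [hX, hY]
    by_cases hcv : c = v
    · subst hcv
      rw [hf0, if_pos rfl, ht]
      field_simp
      rw [hδ]
      ring
    · rw [hf2 v (Finset.mem_union_left _ hv) (iff_of_true hv hcX) (Ne.symm hcv), if_neg hcv, ht]
      field_simp
      rw [hδ]
      ring
  · have hcX : c ∉ X := fun h => hnot c h hcY
    have hX : ∑ w ∈ X, f w = X.card * (s + t) := by
      rw [Finset.sum_congr rfl fun w hw => hf1 w (Finset.mem_union_left _ hw)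
        (iff_of_true hw hcY)]
      simp [mul_add]
    have hY := hsum Y hcY fun w hw hwc =>
      hf2 w (Finset.mem_union_right _ hw) (iff_of_false (fun h => hnot w h hw) hcX) hwc
    have hcv : c ≠ v := by
      rintro rfl
      exact hcX hv
    rw [hX, hY, hf1 v (Finset.mem_union_left _ hv) (iff_of_true hv hcY), if_neg hcv, ht]
    field_simp
    rw [hδ]
    ring

end BlockIdentity

/-! ### Distances inside a block -/

section Distances

variable {V : Type*} [DecidableEq V] {G : SimpleGraph V} {H : G.Subgraph} {X Y : Finset V}

theorem IsCompleteBipartite.symm (h : IsCompleteBipartite H X Y) : IsCompleteBipartite H Y X where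
  nonempty_left := h.nonempty_right
  nonempty_right := h.nonempty_left
  disjoint := h.disjoint.symm
  verts_eq := by rw [h.verts_eq, Finset.union_comm]
  adj_iff u v := by rw [h.adj_iff, or_comm]

theorem IsCompleteBipartite.mem_verts (h : IsCompleteBipartite H X Y) {v : V} :
    v ∈ H.verts ↔ v ∈ X ∪ Y := by
  rw [h.verts_eq, Finset.mem_coe]

theorem IsCompleteBipartite.adj_iff_of_mem (h : IsCompleteBipartite H X Y) (hH : IsBlock H)
    {w v : V} (hv : v ∈ X) (hw : w ∈ X ∪ Y) : G.Adj w v ↔ w ∈ Y := by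
  constructor
  · intro hadj
    have hadj' := hH.adj_of_adj (h.mem_verts.2 hw)
      (h.mem_verts.2 (Finset.mem_union_left _ hv)) hadj
    rcases (h.adj_iff w v).1 hadj' with h' | h'
    · exact absurd h'.2 (Finset.disjoint_left.1 h.disjoint hv)
    · exact h'.1
  · intro hw
    exact ((h.adj_iff w v).2 (Or.inr ⟨hw, hv⟩)).adj_sub

theorem IsCompleteBipartite.dist_eq_one (h : IsCompleteBipartite H X Y) {c w : V}
    (hc : c ∈ X) (hw : w ∈ Y) : G.dist c w = 1 :=
  SimpleGraph.dist_eq_one_iff_adj.2 ((h.adj_iff c w).2 (Or.inl ⟨hc, hw⟩)).adj_sub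

theorem IsCompleteBipartite.dist_eq_two (h : IsCompleteBipartite H X Y) (hH : IsBlock H)
    {c w : V} (hc : c ∈ X) (hw : w ∈ X) (hcw : w ≠ c) : G.dist c w = 2 := by
  obtain ⟨z, hz⟩ := h.nonempty_right
  have h1 : G.Adj c z := ((h.adj_iff c z).2 (Or.inl ⟨hc, hz⟩)).adj_sub
  have h2 : G.Adj z w := ((h.adj_iff z w).2 (Or.inr ⟨hz, hw⟩)).adj_sub
  have hle := G.dist_le (.cons h1 (.cons h2 .nil))
  have hne1 : G.dist c w ≠ 1 := fun hd =>
    Finset.disjoint_left.1 h.disjoint hc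
      ((h.adj_iff_of_mem hH hw (Finset.mem_union_left _ hc)).1
        (SimpleGraph.dist_eq_one_iff_adj.1 hd))
  have hne0 : G.dist c w ≠ 0 :=
    ((h1.reachable.trans h2.reachable).dist_eq_zero_iff.not).2 hcw.symm
  simp only [SimpleGraph.Walk.length_cons, SimpleGraph.Walk.length_nil] at hle
  omega

end Distances

/-! ### The `q`-distance matrix along a gate -/

section QDistance

variable {K : Type*} [Field K] {V : Type*} {G : SimpleGraph V} {H : G.Subgraph}

theorem one_sub_mul_qDistMatrix (q : K) (u v : V) :
    (1 - q) * qDistMatrix G q u v = 1 - q ^ G.dist u v := by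
  rw [qDistMatrix, Matrix.of_apply, mul_comm]
  exact geom_sum_mul_neg q _

theorem IsGate.qDistMatrix_eq {u c w : V} (hG : G.Connected) (hc : IsGate H u c)
    (hw : w ∈ H.verts) (q : K) :
    qDistMatrix G q u w = qDistMatrix G q u c + q ^ G.dist u c * qDistMatrix G q c w := by
  simp only [qDistMatrix, Matrix.of_apply]
  rw [hc.dist_add_dist hG hw, Finset.sum_range_add, Finset.mul_sum]
  simp only [pow_add]

variable [DecidableEq V] {X Y : Finset V}

theorem IsCompleteBipartite.sum_qDistMatrix_column (h : IsCompleteBipartite H X Y)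
    (hG : G.Connected) (hH : IsBlock H) {q δ : K} (hq : q + 1 ≠ 0)
    (hδ : δ = q ^ 2 * ((X.card : K) - 1) * ((Y.card : K) - 1) - 1) (hδ0 : δ ≠ 0) {u v c : V}
    (hv : v ∈ X) (hc : IsGate H u c) :
    q / (q + 1) * (1 / δ) * ∑ w ∈ Y, qDistMatrix G q u w
        - q ^ 2 / (q + 1) * (((Y.card : K) - 1) / δ) * ∑ w ∈ X, qDistMatrix G q u w
        + 1 / (q + 1) * qDistMatrix G q u v
      = (q * ((Y.card : K) - 1) - 1) / ((q + 1) * δ) -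
        if c = v then q ^ G.dist u c else 0 := by
  have hcXY := h.mem_verts.1 hc.mem
  refine sum_completeBipartite_column h.disjoint hq hδ hδ0
    (one_sub_mul_qDistMatrix q u c) hv hcXY (fun w => qDistMatrix G q u w) rfl ?_ ?_
  · intro w hw hwc
    have hd : G.dist c w = 1 := by
      by_cases hcY : c ∈ Y
      · exact h.symm.dist_eq_one hcY (hwc.2 hcY)
      · refine h.dist_eq_one ((Finset.mem_union.1 hcXY).resolve_right hcY) ?_
        exact (Finset.mem_union.1 hw).resolve_left fun h' => hcY (hwc.1 h')
    rw [hc.qDistMatrix_eq hG (h.mem_verts.2 hw) q]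
    simp [qDistMatrix, hd]
  · intro w hw hwc hne
    have hd : G.dist c w = 2 := by
      by_cases hcX : c ∈ X
      · exact h.dist_eq_two hH hcX (hwc.2 hcX) hne
      · refine h.symm.dist_eq_two hH ((Finset.mem_union.1 hcXY).resolve_left hcX) ?_ hne
        exact (Finset.mem_union.1 hw).resolve_left fun h' => hcX (hwc.1 h')
    rw [hc.qDistMatrix_eq hG (h.mem_verts.2 hw) q]
    simp [qDistMatrix, hd, Finset.sum_range_succ]

end QDistance

/-! ### Decomposition of `L` over the blocks -/

namespace BlockLabelling

variable {K : Type*} [Field K] {V : Type*} [DecidableEq V] {G : SimpleGraph V} {r : ℕ}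

open Classical in
/-- The contribution of the `i`-th block to `L`. It is supported on the vertices of the block and
would be all of `L` if there were no other block. -/
noncomputable def blockL (P : BlockLabelling G r) (q : K) (i : Fin r) (w v : V) : K :=
  q / (q + 1) *
      (if G.Adj w v ∧ w ∈ P.X i ∪ P.Y i ∧ v ∈ P.X i ∪ P.Y i then 1 / P.den q i else 0)
    - q ^ 2 / (q + 1) *
      (if w ≠ v ∧ ¬ G.Adj w v ∧ w ∈ P.X i ∧ v ∈ P.X i then ((P.n i : K) - 1) / P.den q i
      else if w ≠ v ∧ ¬ G.Adj w v ∧ w ∈ P.Y i ∧ v ∈ P.Y i then ((P.m i : K) - 1) / P.den q i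
      else 0)
    + if w = v then
        1 / (q + 1) * (if v ∈ P.X i ∪ P.Y i then 1 else 0)
        - q ^ 2 / (q + 1) *
          ((if v ∈ P.X i then ((P.n i : K) - 1) / P.den q i else 0)
            + if v ∈ P.Y i then ((P.m i : K) - 1) / P.den q i else 0)
      else 0

/-- The diagonal correction arises because the blocks at `v` contribute `1 / (q + 1)` each, while
`L` contains this term once, and because `y v` contains `-(d - 1)` for the block degree `d`. -/
theorem L_eq_sum_blockL (P : BlockLabelling G r) {q : K} (hq : q + 1 ≠ 0) (w v : V) :
    P.L q w v = ∑ i, P.blockL q i w v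
      + if w = v then ((P.blockDegree v : K) - 1) * (q - 1) else 0 := by
  have hdeg : (P.blockDegree v : K) = ∑ i, if v ∈ P.X i ∪ P.Y i then (1 : K) else 0 := by
    simp [blockDegree]
  simp only [L, A, B, blockL, Matrix.add_apply, Matrix.sub_apply, Matrix.smul_apply,
    Matrix.of_apply, smul_eq_mul, Finset.sum_add_distrib, Finset.sum_sub_distrib,
    ← Finset.mul_sum]
  by_cases hwv : w = v
  · subst hwv
    simp only [if_true, Matrix.diagonal_apply_eq, Matrix.one_apply_eq, Finset.sum_add_distrib,
      Finset.sum_sub_distrib, ← Finset.mul_sum, y]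
    rw [hdeg]
    field_simp
    ring
  · simp [hwv]

theorem blockL_of_mem_X (P : BlockLabelling G r) (q : K) {i : Fin r} {v : V} (hv : v ∈ P.X i)
    (w : V) :
    P.blockL q i w v = (if w ∈ P.Y i then q / (q + 1) * (1 / P.den q i) else 0)
      - (if w ∈ P.X i then q ^ 2 / (q + 1) * (((P.n i : K) - 1) / P.den q i) else 0)
      + if w = v then 1 / (q + 1) else 0 := by
  have h := P.isCompleteBipartite i
  have hadj := h.adj_iff_of_mem (w := w) (P.block i).2 hv
  have hd : ∀ z, z ∈ P.X i → z ∉ P.Y i := fun z hz hz' => Finset.disjoint_left.1 h.disjoint hz hz'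
  have hvY := hd v hv
  by_cases hwv : w = v
  · subst hwv
    simp [blockL, hv, hvY]
    ring
  · by_cases hwX : w ∈ P.X i
    · have hwY := hd w hwX
      have : ¬ G.Adj w v := by simpa [hwX, hwY] using hadj
      simp [blockL, hv, hwv, hwX, hwY, this]
    · by_cases hwY : w ∈ P.Y i
      · have : G.Adj w v := by simpa [hwY] using hadj
        simp [blockL, hv, hwv, hwX, hwY, this]
      · simp [blockL, hwv, hwX, hwY]

theorem blockL_of_mem_Y (P : BlockLabelling G r) (q : K) {i : Fin r} {v : V} (hv : v ∈ P.Y i)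
    (w : V) :
    P.blockL q i w v = (if w ∈ P.X i then q / (q + 1) * (1 / P.den q i) else 0)
      - (if w ∈ P.Y i then q ^ 2 / (q + 1) * (((P.m i : K) - 1) / P.den q i) else 0)
      + if w = v then 1 / (q + 1) else 0 := by
  have h := (P.isCompleteBipartite i).symm
  have hadj := h.adj_iff_of_mem (w := w) (P.block i).2 hv
  have hd : ∀ z, z ∈ P.Y i → z ∉ P.X i := fun z hz hz' => Finset.disjoint_left.1 h.disjoint hz hz'
  have hvX := hd v hv
  by_cases hwv : w = v
  · subst hwv
    simp [blockL, hv, hvX]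
    ring
  · by_cases hwY : w ∈ P.Y i
    · have hwX := hd w hwY
      have : ¬ G.Adj w v := by simpa [hwX, hwY] using hadj
      simp [blockL, hv, hwv, hwX, hwY, this]
    · by_cases hwX : w ∈ P.X i
      · have : G.Adj w v := by simpa [hwX] using hadj
        simp [blockL, hv, hwv, hwX, hwY, this]
      · simp [blockL, hwv, hwX, hwY]

theorem blockL_of_notMem (P : BlockLabelling G r) (q : K) {i : Fin r} {v : V}
    (hv : v ∉ P.X i ∪ P.Y i) (w : V) : P.blockL q i w v = 0 := by
  have hvX : v ∉ P.X i := fun h => hv (Finset.mem_union_left _ h)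
  have hvY : v ∉ P.Y i := fun h => hv (Finset.mem_union_right _ h)
  simp [blockL, hvX, hvY]

open Classical in
/-- The product of the `q`-distance matrix with the contribution of one block. -/
theorem sum_qDistMatrix_mul_blockL [Fintype V] (P : BlockLabelling G r) (hG : G.Connected) {q : K}
    (hq : q + 1 ≠ 0) {i : Fin r} (hδ : P.den q i ≠ 0) (u v : V) :
    ∑ w, qDistMatrix G q u w * P.blockL q i w v =
      (if v ∈ P.X i then (q * ((P.n i : K) - 1) - 1) / ((q + 1) * P.den q i) else 0)
      + (if v ∈ P.Y i then (q * ((P.m i : K) - 1) - 1) / ((q + 1) * P.den q i) else 0)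
      - if IsGate (P.block i).1 u v then q ^ G.dist u v else 0 := by
  have h := P.isCompleteBipartite i
  obtain ⟨c, hc⟩ := (P.block i).2.exists_isGate hG u
  have hgate : (if IsGate (P.block i).1 u v then q ^ G.dist u v else 0)
      = if c = v then q ^ G.dist u c else 0 := by
    by_cases hcv : c = v
    · subst hcv
      simp [hc]
    · rw [if_neg hcv, if_neg fun hv => hcv (hc.unique hG hv)]
  rw [hgate]
  by_cases hvX : v ∈ P.X i
  · have hvY : v ∉ P.Y i := Finset.disjoint_left.1 h.disjoint hvX
    have key := h.sum_qDistMatrix_column hG (P.block i).2 hq (δ := P.den q i) rfl hδ hvX hc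
    simp only [P.blockL_of_mem_X q hvX, mul_add, mul_sub, Finset.sum_add_distrib,
      Finset.sum_sub_distrib, mul_ite, mul_zero, Finset.sum_ite_eq', Finset.mem_univ, if_true,
      Finset.sum_ite_mem, Finset.univ_inter, ← Finset.sum_mul, hvX, hvY, if_false, add_zero]
    simp only [mul_comm (Finset.sum _ _), mul_comm (qDistMatrix G q u v)]
    rw [← mul_sub]
    exact key
  · by_cases hvY : v ∈ P.Y i
    · have key := h.symm.sum_qDistMatrix_column hG (P.block i).2 hq (δ := P.den q i)
        (by rw [den, m, n]; ring) hδ hvY hc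
      simp only [P.blockL_of_mem_Y q hvY, mul_add, mul_sub, Finset.sum_add_distrib,
        Finset.sum_sub_distrib, mul_ite, mul_zero, Finset.sum_ite_eq', Finset.mem_univ, if_true,
        Finset.sum_ite_mem, Finset.univ_inter, ← Finset.sum_mul, hvX, hvY, if_false, zero_add]
      simp only [mul_comm (Finset.sum _ _), mul_comm (qDistMatrix G q u v)]
      rw [← mul_sub]
      exact key
    · have hcv : c ≠ v := by
        rintro rfl
        exact (Finset.mem_union.1 (h.mem_verts.1 hc.mem)).elim hvX hvY
      have hv : v ∉ P.X i ∪ P.Y i := fun hv => (Finset.mem_union.1 hv).elim hvX hvY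
      simp [P.blockL_of_notMem q hv, hvX, hvY, hcv]

open Classical in
theorem card_isGate_self (P : BlockLabelling G r) (v : V) :
    (Finset.univ.filter fun i => IsGate (P.block i).1 v v).card = P.blockDegree v := by
  rw [blockDegree]
  congr 1
  ext i
  simp only [Finset.mem_filter_univ]
  rw [← (P.isCompleteBipartite i).mem_verts]
  exact ⟨fun h => h.mem, fun h => ⟨h, fun w _ p => p.start_mem_support⟩⟩

open Classical in
/-- For `u ≠ v`, the vertex `v` is the gate of `u` in all blocks at `v` but one. -/
theorem card_isGate_add_one [Finite V] (P : BlockLabelling G r) (hG : G.Connected) {u v : V}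
    (huv : u ≠ v) :
    (Finset.univ.filter fun i => IsGate (P.block i).1 u v).card + 1 = P.blockDegree v := by
  obtain ⟨H, ⟨hH, hvH, hgH⟩, huniq⟩ := existsUnique_isBlock_not_isGate hG huv
  obtain ⟨j, hj⟩ := P.block.surjective ⟨H, hH⟩
  have hjH : (P.block j).1 = H := congrArg Subtype.val hj
  rw [blockDegree, ← Finset.card_insert_of_notMem (a := j) (by simpa [hjH] using hgH)]
  congr 1
  ext i
  simp only [Finset.mem_filter_univ, Finset.mem_insert]
  rw [← (P.isCompleteBipartite i).mem_verts]
  constructor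
  · rintro (rfl | h)
    · rw [hjH]
      exact hvH
    · exact h.mem
  · intro hv
    by_cases hg : IsGate (P.block i).1 u v
    · exact Or.inr hg
    · refine Or.inl (P.block.injective (Subtype.ext ?_))
      rw [hjH]
      exact huniq _ ⟨(P.block i).2, hv, hg⟩

end BlockLabelling

end BiBlock

theorem mainTheorem3 {K : Type*} [Field K] {V : Type*} [Fintype V] [DecidableEq V]
    (G : SimpleGraph V) (hG : BiBlock.IsBiBlockGraph G)
    (r : ℕ) (hr : 1 < r) (P : BiBlock.BlockLabelling G r)
    (q : K) (hq1 : P.Condition1 q) (hq2 : P.Condition2 q) :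
    BiBlock.qDistMatrix G q * P.L q + 1 =
      Matrix.vecMulVec (fun _ : V => (1 : K)) (P.x q) := by
  classical
  have hq : q + 1 ≠ 0 := fun h => hq1.1 (eq_neg_of_add_eq_zero_left h)
  have hδ : ∀ i, P.den q i ≠ 0 := fun i => sub_ne_zero.2 (hq1.2 i)
  ext u v
  have hsum : ∑ i, (if BiBlock.IsGate (P.block i).1 u v then q ^ G.dist u v else 0)
      = ((Finset.univ.filter fun i => BiBlock.IsGate (P.block i).1 u v).card : K)
        * q ^ G.dist u v := by
    rw [← Finset.sum_filter, Finset.sum_const, nsmul_eq_mul]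
  simp only [Matrix.add_apply, Matrix.mul_apply, Matrix.vecMulVec_apply, one_mul,
    P.L_eq_sum_blockL hq, mul_add, Finset.sum_add_distrib, Finset.mul_sum, mul_ite, mul_zero,
    Finset.sum_ite_eq', Finset.mem_univ, if_true]
  rw [Finset.sum_comm, Finset.sum_congr rfl fun i _ =>
    P.sum_qDistMatrix_mul_blockL hG.1 hq (hδ i) u v, Finset.sum_sub_distrib,
    Finset.sum_add_distrib, hsum, BiBlock.BlockLabelling.x]
  -- The diagonal entries differ: there `v` is a gate in one block more, and the identity matrix
  -- makes up for it.
  by_cases huv : u = v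
  · subst huv
    rw [P.card_isGate_self, Matrix.one_apply_eq]
    simp [BiBlock.qDistMatrix]
    ring
  · rw [← P.card_isGate_add_one hG.1 huv, Matrix.one_apply_ne huv]
    push_cast
    linear_combination
      (-((Finset.univ.filter fun i => BiBlock.IsGate (P.block i).1 u v).card : K))
        * BiBlock.one_sub_mul_qDistMatrix (G := G) q u v
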